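/- Theorem 1. Consider the following game of Brassard, Cleve and Tapp with parameter $n=4$. Alice and Bob, who cannot communicate, receive strings $x_A,x_B\in\{0,1\}^{16}$, respectively, such that the Hamming distance satisfies $d_H(x_A,x_B)\in\{0,8\}$. They answer with strings $y_A,y_B\in\{0,1\}^{4}$, respectively, and win if and only if ($y_A=y_B \Longleftrightarrow x_A=x_B$). A classical strategy consists of a random variable $s$ shared by the two players, with an arbitrary law on an arbitrary measurable space, and, for each player, a probability distribution of the answer that depends only (and measurably in $s$) on the player's own question and on $s$, the two answers being conditionally independent given $s$; deterministic strategies are a special case. Then no classical strategy wins this game with certainty: for every classical strategy there is an admissible pair of questions $(x_A,x_B)$ for which the probability of winning is less than $1$. -/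

import Mathlib

open MeasureTheory ProbabilityTheory

/-- A two-player game without communication: a relation on pairs of questions, and a relation
saying which answers win on which questions. -/
structure TwoPlayerGame (XA XB YA YB : Type*) where
  /-- The pairs of questions that may be asked. -/
  promise : XA → XB → Prop
  /-- The answers `yA`, `yB` are correct for the questions `xA`, `xB`. -/
  correct : XA → XB → YA → YB → Prop

/-- A classical strategy: the players share a random variable with values in `S` (of any size
and with any law) and each of them answers according to a probability distribution that depends
only on the own question and on the shared value. Deterministic strategies are the case
in which all the measures are Dirac measures. -/
structure ClassicalStrategy (S XA XB YA YB : Type*)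
    [MeasurableSpace S] [MeasurableSpace YA] [MeasurableSpace YB] where
  /-- The law of the shared randomness. -/
  law : Measure S
  isProbabilityMeasure_law : IsProbabilityMeasure law
  /-- `alice xA s` is the law of Alice's answer to `xA`, given the shared value `s`. -/
  alice : XA → Kernel S YA
  isMarkovKernel_alice : ∀ xA, IsMarkovKernel (alice xA)
  /-- `bob xB s` is the law of Bob's answer to `xB`, given the shared value `s`. -/
  bob : XB → Kernel S YB
  isMarkovKernel_bob : ∀ xB, IsMarkovKernel (bob xB)

namespace ClassicalStrategy

variable {S XA XB YA YB : Type*} [MeasurableSpace S] [MeasurableSpace YA] [MeasurableSpace YB]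

/-- The joint law of the two answers to the questions `xA`, `xB`: given the shared value,
the two answers are independent. -/
noncomputable def answers (σ : ClassicalStrategy S XA XB YA YB) (xA : XA) (xB : XB) :
    Measure (YA × YB) :=
  σ.law.bind (fun s => (σ.alice xA s).prod (σ.bob xB s))

/-- The strategy wins the game with certainty: on every admissible pair of questions, the answers
are correct with probability one. -/
def WinsWithCertainty (σ : ClassicalStrategy S XA XB YA YB)
    (G : TwoPlayerGame XA XB YA YB) : Prop :=
  ∀ xA xB, G.promise xA xB → ∀ᵐ y ∂(σ.answers xA xB), G.correct xA xB y.1 y.2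

end ClassicalStrategy

/-- The game of Brassard, Cleve and Tapp with parameter `n ≥ 1`: the questions are bit strings of
length `N = 2 ^ n` that are equal or differ in exactly `N / 2` positions; the answers are bit
strings of length `n` that have to be equal if and only if the questions are. -/
def brassardCleveTappGame (n : ℕ) :
    TwoPlayerGame (Fin (2 ^ n) → Bool) (Fin (2 ^ n) → Bool) (Fin n → Bool) (Fin n → Bool) where
  promise xA xB := hammingDist xA xB = 0 ∨ hammingDist xA xB = 2 ^ n / 2
  correct xA xB yA yB := yA = yB ↔ xA = xB

/-! Almost surely the shared value leaves strategies whose positive-probability answers are all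
correct, so a perfect strategy yields a deterministic one. Equal questions force both players to use
one map `f`, a colouring with 16 colours in which words at distance 8 differ. Among the 2^14 even
words with first bit zero, some colour occurs at least 1024 times. A modular rank argument bounds
such a class by 816: the integers C(d/2 - 1, 3), with d the distance, form a matrix that is the
identity modulo 2, hence nonsingular over ℚ, while its rows are cubic forms in 16 variables. -/

/-- The cubic monomial function indexed by a multiset of three coordinates. -/
def cubicMonomial {ι : Type*} (s : Sym ι 3) (v : ι → ℚ) : ℚ := ((s : Multiset ι).map v).prod

lemma mul_mul_mem_span_cubicMonomial {ι X : Type*} [Fintype ι] (v : X → ι → ℚ) (a b c : ι → ℚ) :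
    (fun x => (∑ i, a i * v x i) * (∑ i, b i * v x i) * (∑ i, c i * v x i)) ∈
      Submodule.span ℚ (Set.range fun (s : Sym ι 3) (x : X) => cubicMonomial s (v x)) := by
  have h : (fun x => (∑ i, a i * v x i) * (∑ i, b i * v x i) * (∑ i, c i * v x i)) =
      ∑ i, ∑ j, ∑ k, (a i * c j * b k) •
        (fun x => cubicMonomial (⟨{i, j, k}, rfl⟩ : Sym ι 3) (v x)) := by
    funext x
    simp only [Finset.sum_apply, Pi.smul_apply, smul_eq_mul, Finset.sum_mul_sum]
    simp only [Finset.sum_mul]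
    refine Finset.sum_congr rfl fun i _ => Finset.sum_congr rfl fun j _ =>
      Finset.sum_congr rfl fun k _ => ?_
    simp only [cubicMonomial, Sym.coe_mk, Multiset.insert_eq_cons, Multiset.map_cons,
      Multiset.map_singleton, Multiset.prod_cons, Multiset.prod_singleton]
    ring
  rw [h]
  exact Submodule.sum_mem _ fun i _ => Submodule.sum_mem _ fun j _ => Submodule.sum_mem _ fun k _ =>
    Submodule.smul_mem _ _ (Submodule.subset_span ⟨_, rfl⟩)

/-- Modulo 2 the matrix is the identity, so its determinant is odd. -/
lemma det_ne_zero_of_odd_diag {X : Type*} [Fintype X] [DecidableEq X] (M : Matrix X X ℤ)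
    (hd : ∀ x, Odd (M x x)) (ho : ∀ x y, x ≠ y → Even (M x y)) : M.det ≠ 0 := by
  intro h0
  have h1 : M.map (Int.castRingHom (ZMod 2)) = 1 := by
    ext x y
    rcases eq_or_ne x y with rfl | hxy
    · simpa [Matrix.map_apply] using (ZMod.intCast_eq_one_iff_odd).2 (hd x)
    · simpa [Matrix.map_apply, Matrix.one_apply_ne hxy] using
        (ZMod.intCast_eq_zero_iff_even).2 (ho x y hxy)
  have h2 := (Int.castRingHom (ZMod 2)).map_det M
  rw [h0, RingHom.mapMatrix_apply, h1, Matrix.det_one, map_zero] at h2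
  exact zero_ne_one h2

/-- A modular rank bound: if an integer matrix with odd diagonal and even entries off the diagonal
is given by a product of three bilinear forms, then its size is at most the number of cubic
monomials. -/
lemma card_le_of_cubic_odd_diag {ι X : Type*} [Fintype ι] [DecidableEq ι] [Fintype X]
    [DecidableEq X] (M : Matrix X X ℤ)
    (hd : ∀ x, Odd (M x x)) (ho : ∀ x y, x ≠ y → Even (M x y))
    (v : X → ι → ℚ) (a b c : X → ι → ℚ)
    (hM : ∀ y x, (M y x : ℚ) =
      (∑ i, a y i * v x i) * (∑ i, b y i * v x i) * (∑ i, c y i * v x i)) :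
    Fintype.card X ≤ (Fintype.card ι).multichoose 3 := by
  have hdet : IsUnit (M.map (Int.castRingHom ℚ)) := by
    rw [Matrix.isUnit_iff_isUnit_det, isUnit_iff_ne_zero]
    have := (Int.castRingHom ℚ).map_det M
    rw [RingHom.mapMatrix_apply] at this
    rw [← this]
    simpa using det_ne_zero_of_odd_diag M hd ho
  have hli := Matrix.linearIndependent_rows_iff_isUnit.2 hdet
  set m : Sym ι 3 → X → ℚ := fun s x => cubicMonomial s (v x) with hm
  have hmem : ∀ y, (M.map (Int.castRingHom ℚ)).row y ∈ Submodule.span ℚ (Set.range m) := by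
    intro y
    convert mul_mul_mem_span_cubicMonomial v (a y) (b y) (c y) using 1
    funext x
    simpa [Matrix.row] using hM y x
  have hspan : Submodule.span ℚ (Set.range (M.map (Int.castRingHom ℚ)).row) ≤
      Submodule.span ℚ (Set.range m) := by
    rw [Submodule.span_le]
    rintro _ ⟨y, rfl⟩
    exact hmem y
  calc Fintype.card X
      = Module.finrank ℚ (Submodule.span ℚ (Set.range (M.map (Int.castRingHom ℚ)).row)) :=
        (finrank_span_eq_card hli).symm
    _ ≤ Module.finrank ℚ (Submodule.span ℚ (Set.range m)) := Submodule.finrank_mono hspan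
    _ ≤ Fintype.card (Sym ι 3) := finrank_range_le_card m
    _ = _ := Sym.card_sym_eq_multichoose ι 3

/-- The sign of a bit. -/
def bitSign (b : Bool) : ℤ := if b then -1 else 1

lemma bitSign_mul (a b : Bool) : bitSign a * bitSign b = if a ≠ b then -1 else 1 := by
  cases a <;> cases b <;> rfl

lemma sum_bitSign_mul {ι : Type*} [Fintype ι] (x y : ι → Bool) :
    ∑ i, bitSign (x i) * bitSign (y i) = Fintype.card ι - 2 * hammingDist x y := by
  have h : ∀ i, bitSign (x i) * bitSign (y i) = 1 - 2 * (if x i ≠ y i then 1 else 0) := by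
    intro i
    rw [bitSign_mul]
    split_ifs <;> rfl
  simp only [h, Finset.sum_sub_distrib, ← Finset.mul_sum, Finset.sum_boole]
  simp [hammingDist]

lemma prod_bitSign_mul {ι : Type*} [Fintype ι] (x y : ι → Bool) :
    (∏ i, bitSign (x i)) * ∏ i, bitSign (y i) = (-1) ^ hammingDist x y := by
  rw [← Finset.prod_mul_distrib]
  simp only [bitSign_mul, Finset.prod_ite, Finset.prod_const, one_pow, mul_one]
  rfl

/-- A set of bit strings of length 16 with first bit zero and even weight, no two of which
are orthogonal as sign vectors, has at most 816 elements. -/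
lemma card_le_of_hammingDist_ne_eight (F : Finset (Fin 16 → Bool))
    (h0 : ∀ x ∈ F, x 0 = false) (hpar : ∀ x ∈ F, ∏ i, bitSign (x i) = 1)
    (h8 : ∀ x ∈ F, ∀ y ∈ F, hammingDist x y ≠ 8) : F.card ≤ 816 := by
  -- Here m = C(d/2 - 1, 3), written through u = 4 - d/2, a quarter of the inner product of the sign
  -- vectors. The last clause records that d is even, so that the integer division is exact.
  have key : ∀ y x : F, ∃ m : ℤ, (x = y → Odd m) ∧ (y ≠ x → Even m) ∧
      6 * m = (1 - (4 - hammingDist y.1 x.1 / 2 : ℤ)) * (2 - (4 - hammingDist y.1 x.1 / 2 : ℤ)) *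
        (3 - (4 - hammingDist y.1 x.1 / 2 : ℤ)) ∧
      2 * ((hammingDist y.1 x.1 : ℤ) / 2) = hammingDist y.1 x.1 := by
    rintro ⟨y, hy⟩ ⟨x, hx⟩
    have hev : Even (hammingDist y x) := by
      have := prod_bitSign_mul y x
      rw [hpar x hx, hpar y hy, one_mul] at this
      exact (neg_one_pow_eq_one_iff_even (by norm_num)).1 this.symm
    -- The common first bit rules out d = 16, where m = 35 would be odd.
    have hlt : hammingDist y x < 16 := by
      have : hammingDist y x < (Finset.univ : Finset (Fin 16)).card := by
        refine Finset.card_lt_card (Finset.filter_ssubset.2 ⟨0, Finset.mem_univ _, ?_⟩)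
        simp [h0 x hx, h0 y hy]
      simpa using this
    have hne := h8 y hy x hx
    have hz : hammingDist y x = 0 ↔ y = x := hammingDist_eq_zero
    simp only [Subtype.mk.injEq, ne_eq]
    rw [eq_comm (a := x), ← hz]
    generalize hammingDist y x = d at *
    obtain ⟨e, rfl⟩ := hev
    have he : e < 8 := by omega
    interval_cases e
    · exact ⟨-1, by decide, by decide, by norm_num⟩
    · exact ⟨0, by decide, by decide, by norm_num⟩
    · exact ⟨0, by decide, by decide, by norm_num⟩
    · exact ⟨0, by decide, by decide, by norm_num⟩
    -- This is d = 8, the only other off-diagonal case with m odd (m = 1).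
    · exact absurd rfl hne
    · exact ⟨4, by decide, by decide, by norm_num⟩
    · exact ⟨10, by decide, by decide, by norm_num⟩
    · exact ⟨20, by decide, by decide, by norm_num⟩
  choose M hMd hMo hM hdist using key
  -- Since the sign of `x 0` is 1, the constant r is a linear form too. The cubics are thus
  -- homogeneous, and C(18, 3) = 816 monomials suffice.
  have lin : ∀ (y x : F) (r : ℚ),
      ∑ i, ((if i = 0 then r else 0) - bitSign (y.1 i) / 4 : ℚ) * (bitSign (x.1 i) : ℚ) =
        r - (4 - ((hammingDist y.1 x.1 : ℤ) / 2 : ℤ) : ℚ) := by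
    intro y x r
    have h1 := congrArg (Int.cast : ℤ → ℚ) (sum_bitSign_mul y.1 x.1)
    have h2 := congrArg (Int.cast : ℤ → ℚ) (hdist y x)
    push_cast [Fintype.card_fin] at h1 h2
    simp only [sub_mul, Finset.sum_sub_distrib, ite_mul, zero_mul, Finset.sum_ite_eq',
      Finset.mem_univ, if_true, div_mul_eq_mul_div, ← Finset.sum_div, h1, h0 x.1 x.2]
    rw [← h2]
    simp [bitSign]
    ring
  have := card_le_of_cubic_odd_diag (Matrix.of M) (fun x => hMd x x rfl)
    (fun y x hyx => hMo y x hyx) (fun (x : F) (i : Fin 16) => (bitSign (x.1 i) : ℚ))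
    (fun y i => 1 / 6 * ((if i = 0 then 1 else 0) - bitSign (y.1 i) / 4))
    (fun y i => (if i = 0 then 2 else 0) - bitSign (y.1 i) / 4)
    (fun y i => (if i = 0 then 3 else 0) - bitSign (y.1 i) / 4) (by
      intro y x
      have h := congrArg (Int.cast : ℤ → ℚ) (hM y x)
      simp only [mul_assoc (1 / 6 : ℚ), ← Finset.mul_sum, lin, Matrix.of_apply]
      push_cast at h ⊢
      linarith)
  have hc : (Fintype.card (Fin 16)).multichoose 3 = 816 := by
    rw [Fintype.card_fin, Nat.multichoose_eq]; rfl
  rw [hc] at this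
  simpa using this

/-- The word of even weight with first bit zero whose middle bits are given. -/
def evenWord (z : Fin 14 → Bool) : Fin 16 → Bool :=
  Fin.cons false (Fin.snoc z (decide (∏ i, bitSign (z i) = -1)) : Fin 15 → Bool)

lemma evenWord_injective : Function.Injective evenWord := by
  intro z w h
  exact (Fin.snoc_injective2 (Fin.cons_injective2 h).2).1

lemma prod_bitSign_evenWord (z : Fin 14 → Bool) : ∏ i, bitSign (evenWord z i) = 1 := by
  have hz : ∏ i, bitSign (z i) = 1 ∨ ∏ i, bitSign (z i) = -1 := by
    refine Int.isUnit_iff.1 ?_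
    rw [IsUnit.prod_univ_iff]
    intro i
    cases z i <;> simp [bitSign]
  rw [evenWord, Fin.prod_univ_succ, Fin.prod_univ_castSucc (n := 14)]
  simp only [Fin.cons_zero, Fin.cons_succ, Fin.snoc_castSucc, Fin.snoc_last]
  rcases hz with hz | hz <;> rw [hz] <;> rfl

/-- The graph on the bit strings of length 16 in which strings at distance 8 are adjacent
has no proper colouring with 16 colours. -/
lemma exists_hammingDist_eq_eight_of_coloring (f : (Fin 16 → Bool) → (Fin 4 → Bool)) :
    ∃ x y, hammingDist x y = 8 ∧ f x = f y := by
  by_contra! h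
  -- 16 * 1024 = 2^14.
  obtain ⟨c, hc⟩ := Fintype.exists_le_card_fiber_of_mul_le_card (fun z => f (evenWord z))
    (n := 1024) (by simp)
  have := card_le_of_hammingDist_ne_eight
    ((Finset.univ.filter fun z => f (evenWord z) = c).image evenWord)
    (by simp [evenWord]) (by simp [prod_bitSign_evenWord])
    (by
      intro x hx y hy h8
      obtain ⟨z, hz, rfl⟩ := Finset.mem_image.1 hx
      obtain ⟨w, hw, rfl⟩ := Finset.mem_image.1 hy
      exact h _ _ h8 ((Finset.mem_filter.1 hz).2.trans (Finset.mem_filter.1 hw).2.symm))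
  rw [Finset.card_image_of_injective _ evenWord_injective] at this
  omega

lemma exists_measure_singleton_ne_zero {Y : Type*} [MeasurableSpace Y] [Countable Y]
    (μ : Measure Y) [IsProbabilityMeasure μ] : ∃ y, μ {y} ≠ 0 := by
  by_contra! h
  exact IsProbabilityMeasure.ne_zero μ (Measure.measure_univ_eq_zero.1
    ((measure_null_iff_singleton Set.countable_univ).2 fun y _ => h y))

/-- A classical strategy that wins with certainty yields a deterministic one. -/
lemma ClassicalStrategy.WinsWithCertainty.exists_deterministic {S XA XB YA YB : Type*}
    [MeasurableSpace S] [MeasurableSpace YA] [MeasurableSpace YB] [Countable XA] [Countable XB]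
    [Countable YA] [Countable YB]
    {σ : ClassicalStrategy S XA XB YA YB} {G : TwoPlayerGame XA XB YA YB}
    (h : σ.WinsWithCertainty G) :
    ∃ (f : XA → YA) (g : XB → YB), ∀ xA xB, G.promise xA xB → G.correct xA xB (f xA) (g xB) := by
  have := σ.isProbabilityMeasure_law
  have := σ.isMarkovKernel_alice
  have := σ.isMarkovKernel_bob
  have hs : ∀ᵐ s ∂σ.law, ∀ xA xB, G.promise xA xB →
      ∀ᵐ y ∂((σ.alice xA s).prod (σ.bob xB s)), G.correct xA xB y.1 y.2 := by
    simp only [ae_all_iff]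
    intro xA xB hp
    refine Measure.ae_ae_of_ae_bind ?_ (h xA xB hp)
    have hk : (fun s => (σ.alice xA s).prod (σ.bob xB s)) = ⇑(σ.alice xA ×ₖ σ.bob xB) :=
      funext fun s => (Kernel.prod_apply _ _ s).symm
    exact hk ▸ (σ.alice xA ×ₖ σ.bob xB).measurable.aemeasurable
  -- One s serves all questions, as there are countably many. Any two atoms then have positive
  -- product mass, so they must be correct together.
  obtain ⟨s, hs⟩ := hs.exists
  choose f hf using fun xA => exists_measure_singleton_ne_zero (σ.alice xA s)
  choose g hg using fun xB => exists_measure_singleton_ne_zero (σ.bob xB s)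
  refine ⟨f, g, fun xA xB hp => ?_⟩
  by_contra hc
  have h0 : ((σ.alice xA s).prod (σ.bob xB s)) ({f xA} ×ˢ {g xB}) = 0 := by
    refine measure_mono_null ?_ (ae_iff.1 (hs xA xB hp))
    rintro ⟨a, b⟩ ⟨ha, hb⟩
    obtain rfl : a = f xA := ha
    obtain rfl : b = g xB := hb
    exact hc
  rw [Measure.prod_prod] at h0
  exact mul_ne_zero (hf xA) (hg xB) h0

theorem theorem1 {S : Type*} [MeasurableSpace S]
    (σ : ClassicalStrategy S (Fin (2 ^ 4) → Bool) (Fin (2 ^ 4) → Bool)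
      (Fin 4 → Bool) (Fin 4 → Bool)) :
    ¬ σ.WinsWithCertainty (brassardCleveTappGame 4) := by
  intro h
  obtain ⟨f, g, hfg⟩ := h.exists_deterministic
  obtain ⟨x, y, h8, hxy⟩ := exists_hammingDist_eq_eight_of_coloring f
  have hy : f y = g y := (hfg y y (Or.inl (hammingDist_self y))).2 rfl
  have : x = y := (hfg x y (Or.inr h8)).1 (hxy.trans hy)
  rw [this, hammingDist_self] at h8
  exact absurd h8 (by norm_num)
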